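/- **Setting.** A *precausal category* is a compact closed category $\mathbf C$ (unit $I$, cup $\eta_A : I \to A\otimes A^*$) with a discarding effect $\top_A : A \to I$ for every object $A$ such that $\top_{A\otimes B}=\top_A\otimes\top_B$ and $\top_I = 1$, and such that the following hold, where $f:A\to B$ is called *causal* if $\top_B\circ f=\top_A$, the *uniform state* is $u_A := (\mathrm{id}_A\otimes \top_{A^*})\circ\eta_A : I\to A$, and duals are chosen compatibly with the tensor, so that $u_{A\otimes B}=u_A\otimes u_B$: 1. for every $A$ that is not a zero object the scalar $\top_A\circ u_A$ is invertible; 2. if $f,g:A\to B$ satisfy $f\circ\rho=g\circ\rho$ for all causal states $\rho:I\to A$, then $f=g$; 3. if $w:B\otimes A'\to A\otimes B'$ is such that plugging any causal $\Phi:A\to A'$ into $w$ (feeding the output $A$ of $w$ through $\Phi$ back into its input $A'$, using the cup and cap) gives a causal morphism $B\to B'$, then $w=(\mathrm{id}_A\otimes\Phi_2)\circ(\Phi_1\otimes \mathrm{id}_{A'})$ for some object $E$ and causal $\Phi_1:B\to A\otimes E$, $\Phi_2:E\otimes A'\to B'$. For $c\subseteq\mathbf C(I,A)$ let $c^*=\{\pi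 : A\to I \mid \pi\circ\rho=1 \text{ for all } \rho\in c\}$ (equivalently a set of states of $A^*$), and dually for sets of effects. The category $\mathbf{Caus}(\mathbf C)$ has as objects the pairs $(c,A)$ with $c\subseteq\mathbf C(I,A)$ such that $c^{**}=c$ and $\lambda u_A\in c$, $\mu\top_A\in c^*$ for some invertible scalars $\lambda,\mu$; a morphism $(c,A)\to(c',A')$ is a morphism $f:A\to A'$ of $\mathbf C$ with $f\circ\rho\in c'$ for all $\rho\in c$. It has the tensor product $(c_1,A_1)\otimes(c_2,A_2)=(\{\rho_1\otimes\rho_2 \mid \rho_i\in c_i\}^{**},A_1\otimes A_2)$ with unit $(\{1\},I)$, and the par product $(c_1,A_1)\mathbin{\wp}(c_2,A_2)=(\{\pi_1\otimes\pi_2\mid\pi_i\in c_i^*\}^{*},A_1\otimes A_2)$. Let $\mathbf C_1$ be the full monoidal subcategory (under $\otimes$) of $\mathbf{Caus}(\mathbf C)$ on the *first-order* objects, i.e. those $(c,A)$ for which $c^*$ is a singleton. For a monoidal category $\mathbf D$, let $\mathbf{StProf}(\mathbf D)$ be the category of functors $P:\mathbf D^{op}\times\mathbf D\to\mathbf{Set}$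 equipped with a natural, associative and unital strength $P(X,X')\times\mathbf D(Y,Y')\to P(X\otimes Y,X'\otimes Y')$, and of natural transformations commuting with the strengths. Let $\mathcal F:\mathbf{Caus}(\mathbf C)\to\mathbf{StProf}(\mathbf C_1)$ be the functor $$\mathcal F(A)(X,X')=\mathbf{Caus}(\mathbf C)(X,A\mathbin{\wp}X'),\qquad \mathcal F(f)_{X,X'}(\varphi)=(f\mathbin{\wp}X')\circ\varphi,$$ where $\mathbf C_1$ acts by pre- and postcomposition and the strength sends $(\varphi,g)$, with $\varphi : X\to A\mathbin{\wp}X'$ and $g:Y\to Y'$, to the composite $X\otimes Y\xrightarrow{\varphi\otimes g}(A\mathbin{\wp}X')\otimes Y'\to A\mathbin{\wp}(X'\otimes Y')$, the last map being the associator of $\mathbf C$. **Proposition.** For every precausal category $\mathbf C$, the functor $\mathcal F:\mathbf{Caus}(\mathbf C)\to\mathbf{StProf}(\mathbf C_1)$ is faithful. -/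

import Mathlib

open CategoryTheory MonoidalCategory Opposite

universe w v u

/-! ### Strong profunctors -/

section StrongProfunctors

variable (D : Type u) [Category.{v} D] [MonoidalCategory D]

/-- A strong profunctor on a monoidal category `D`: a functor `P : Dᵒᵖ × D ⥤ Type` with a natural
transformation `ζ : P(A, B) × D(X, Y) ⟶ P(A ⊗ X, B ⊗ Y)` that is associative and unital. -/
structure StrongProfunctor where
  /-- the underlying profunctor -/
  P : Dᵒᵖ × D ⥤ Type w
  /-- the strength -/
  str : ∀ {A B X Y : D}, P.obj (op A, B) → (X ⟶ Y) → P.obj (op (A ⊗ X), B ⊗ Y)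
  str_natural : ∀ {A A' B B' X X' Y Y' : D} (a : A' ⟶ A) (b : B ⟶ B') (x : X' ⟶ X) (y : Y ⟶ Y')
    (p : P.obj (op A, B)) (f : X ⟶ Y),
    str (P.map (X := (op A, B)) (Y := (op A', B')) (Prod.mkHom a.op b) p) (x ≫ f ≫ y) =
      P.map (X := (op (A ⊗ X), B ⊗ Y)) (Y := (op (A' ⊗ X'), B' ⊗ Y'))
        (Prod.mkHom (a ⊗ₘ x).op (b ⊗ₘ y)) (str p f)
  str_unit : ∀ {A B : D} (p : P.obj (op A, B)),
    P.map (X := (op (A ⊗ 𝟙_ D), B ⊗ 𝟙_ D)) (Y := (op A, B))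
      (Prod.mkHom (ρ_ A).inv.op (ρ_ B).hom) (str p (𝟙 (𝟙_ D))) = p
  str_assoc : ∀ {A B X Y Z W : D} (p : P.obj (op A, B)) (f : X ⟶ Y) (g : Z ⟶ W),
    P.map (X := (op ((A ⊗ X) ⊗ Z), (B ⊗ Y) ⊗ W)) (Y := (op (A ⊗ X ⊗ Z), B ⊗ Y ⊗ W))
      (Prod.mkHom (α_ A X Z).inv.op (α_ B Y W).hom) (str (str p f) g) = str p (f ⊗ₘ g)

variable {D}

/-- A strong natural transformation: a natural transformation commuting with the strengths. -/
@[ext]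
structure StrongNatTrans (P Q : StrongProfunctor.{w} D) where
  /-- the underlying natural transformation -/
  nat : P.P ⟶ Q.P
  nat_str : ∀ {A B X Y : D} (p : P.P.obj (op A, B)) (f : X ⟶ Y),
    nat.app (op (A ⊗ X), B ⊗ Y) (P.str p f) = Q.str (nat.app (op A, B) p) f

/-- The category `StProf(D)`. -/
instance : Category (StrongProfunctor.{w} D) where
  Hom P Q := StrongNatTrans P Q
  id P := { nat := 𝟙 P.P, nat_str := fun p f => rfl }
  comp η θ :=
    { nat := η.nat ≫ θ.nat
      nat_str := fun p f =>
        (congrArg _ (η.nat_str p f)).trans (θ.nat_str _ f) }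

end StrongProfunctors

/-! ### Precausal categories -/

/-- An environment structure: discarding effects compatible with the tensor product. -/
class EnvironmentStructure (C : Type u) [Category.{v} C] [MonoidalCategory C] where
  /-- the discarding effect -/
  discard : ∀ A : C, A ⟶ 𝟙_ C
  discard_tensor : ∀ A B : C,
    discard (A ⊗ B) = (discard A ⊗ₘ discard B) ≫ (λ_ (𝟙_ C)).hom
  discard_unit : discard (𝟙_ C) = 𝟙 (𝟙_ C)

section Environment

variable {C : Type u} [Category.{v} C] [MonoidalCategory C] [EnvironmentStructure C]

/-- The discarding effect of `A`. -/
def ground (A : C) : A ⟶ 𝟙_ C := EnvironmentStructure.discard A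

/-- A process is causal if discarding its output is discarding its input. -/
def Causal {A B : C} (f : A ⟶ B) : Prop := f ≫ ground B = ground A

/-- The uniform (flat) state of `A`: the transpose of the discarding effect of the dual of `A`. -/
def uniform [RightRigidCategory C] (A : C) : 𝟙_ C ⟶ A :=
  η_ A (Aᘁ) ≫ A ◁ ground (Aᘁ) ≫ (ρ_ A).hom

/-- A second-order process `w`, drawn as a circuit with a hole of type `A → A'`
and outer type `B → B'`, applied to `Φ : A ⟶ A'`. -/
def fillHole [SymmetricCategory C] [RightRigidCategory C] {A A' B B' : C}
    (w : B ⊗ A' ⟶ A ⊗ B') (Φ : A ⟶ A') : B ⟶ B' :=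
  (ρ_ B).inv ≫ B ◁ η_ A (Aᘁ) ≫ B ◁ (Φ ▷ (Aᘁ)) ≫ (α_ B A' (Aᘁ)).inv ≫ w ▷ (Aᘁ) ≫
    (β_ (A ⊗ B') (Aᘁ)).hom ≫ (α_ (Aᘁ) A B').inv ≫ ε_ A (Aᘁ) ▷ B' ≫ (λ_ B').hom

end Environment

/-- A precausal category: a compact closed category (symmetric monoidal with duals) with an
environment structure, such that every non-zero system has invertible dimension, there are enough
causal states, and second-order causal processes factorise.
The field `uniform_tensor` expresses the usual convention `(A ⊗ B)* = A* ⊗ B*` for the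
chosen duals, under which discarding on `(A ⊗ B)*` is discarding on `A*` and `B*`. -/
class PrecausalCategory (C : Type u) [Category.{v} C] [MonoidalCategory C] [SymmetricCategory C]
    [RightRigidCategory C] extends EnvironmentStructure C where
  uniform_tensor : ∀ A B : C,
    uniform (A ⊗ B) = (λ_ (𝟙_ C)).inv ≫ (uniform A ⊗ₘ uniform B)
  dim_invertible : ∀ A : C, ¬ Limits.IsZero A → IsIso (uniform A ≫ ground A)
  enough_causal_states : ∀ {A B : C} (f g : A ⟶ B),
    (∀ ρ : 𝟙_ C ⟶ A, Causal ρ → ρ ≫ f = ρ ≫ g) → f = g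
  second_order_factorise : ∀ {A A' B B' : C} (w : B ⊗ A' ⟶ A ⊗ B'),
    (∀ Φ : A ⟶ A', Causal Φ → Causal (fillHole w Φ)) →
    ∃ (E : C) (Φ₁ : B ⟶ A ⊗ E) (Φ₂ : E ⊗ A' ⟶ B'), Causal Φ₁ ∧ Causal Φ₂ ∧
      w = Φ₁ ▷ A' ≫ (α_ A E A').hom ≫ A ◁ Φ₂

/-! ### Sets of states and their duals -/

section States

variable {C : Type u} [Category.{v} C] [MonoidalCategory C]

/-- The parallel composite of two states. -/
def tensorState {A B : C} (ρ : 𝟙_ C ⟶ A) (σ : 𝟙_ C ⟶ B) : 𝟙_ C ⟶ A ⊗ B :=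
  (λ_ (𝟙_ C)).inv ≫ (ρ ⊗ₘ σ)

/-- The parallel composite of two effects. -/
def tensorEffect {A B : C} (π : A ⟶ 𝟙_ C) (κ : B ⟶ 𝟙_ C) : A ⊗ B ⟶ 𝟙_ C :=
  (π ⊗ₘ κ) ≫ (λ_ (𝟙_ C)).hom

/-- The dual `c*` of a set of states of `A`. States of the dual object `A*` are written as
effects on `A`, to which they correspond by bending the wire. -/
def dualEffects {A : C} (c : Set (𝟙_ C ⟶ A)) : Set (A ⟶ 𝟙_ C) :=
  {π | ∀ ρ ∈ c, ρ ≫ π = 𝟙 (𝟙_ C)}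

/-- The dual of a set of effects on `A`, i.e. of a set of states of `A*`. -/
def dualStates {A : C} (e : Set (A ⟶ 𝟙_ C)) : Set (𝟙_ C ⟶ A) :=
  {ρ | ∀ π ∈ e, ρ ≫ π = 𝟙 (𝟙_ C)}

/-- The double dual `c**`. -/
def bidual {A : C} (c : Set (𝟙_ C ⟶ A)) : Set (𝟙_ C ⟶ A) := dualStates (dualEffects c)

/-- A set of states is closed if `c** = c`. -/
def IsClosedSet {A : C} (c : Set (𝟙_ C ⟶ A)) : Prop := bidual c = c

/-- A set of states is flat if it contains the uniform state up to an invertible scalar, and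
its dual contains the discarding effect (the uniform state of `A*`) up to an invertible scalar. -/
def IsFlatSet [RightRigidCategory C] [EnvironmentStructure C] {A : C} (c : Set (𝟙_ C ⟶ A)) :
    Prop :=
  (∃ s : 𝟙_ C ⟶ 𝟙_ C, IsIso s ∧ s ≫ uniform A ∈ c) ∧
    ∃ t : 𝟙_ C ⟶ 𝟙_ C, IsIso t ∧ ground A ≫ t ∈ dualEffects c

/-- The set of states of `(c₁, A) ⊗ (c₂, B)`. -/
def tensorSet {A B : C} (c₁ : Set (𝟙_ C ⟶ A)) (c₂ : Set (𝟙_ C ⟶ B)) : Set (𝟙_ C ⟶ A ⊗ B) :=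
  bidual (Set.image2 tensorState c₁ c₂)

/-- The set of states of `(c₁, A) ⅋ (c₂, B)`, that is `(c₁* × c₂*)*`. -/
def parSet {A B : C} (c₁ : Set (𝟙_ C ⟶ A)) (c₂ : Set (𝟙_ C ⟶ B)) : Set (𝟙_ C ⟶ A ⊗ B) :=
  dualStates (Set.image2 tensorEffect (dualEffects c₁) (dualEffects c₂))

/-- Put a fixed state on the right. -/
def addRight (A : C) {B : C} (σ : 𝟙_ C ⟶ B) : A ⟶ A ⊗ B := (ρ_ A).inv ≫ A ◁ σ

/-- Put a fixed state on the left. -/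
def addLeft {A : C} (ρ : 𝟙_ C ⟶ A) (B : C) : B ⟶ A ⊗ B := (λ_ B).inv ≫ ρ ▷ B

lemma comp_addRight {A B : C} (ρ : 𝟙_ C ⟶ A) (σ : 𝟙_ C ⟶ B) :
    ρ ≫ addRight A σ = tensorState ρ σ := by
  simp [addRight, tensorState, MonoidalCategory.tensorHom_def, unitors_inv_equal]

lemma comp_addLeft {A B : C} (ρ : 𝟙_ C ⟶ A) (σ : 𝟙_ C ⟶ B) :
    σ ≫ addLeft ρ B = tensorState ρ σ := by
  simp [addLeft, tensorState, MonoidalCategory.tensorHom_def']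

lemma tensorState_tensorHom {A A' B B' : C} (ρ : 𝟙_ C ⟶ A) (σ : 𝟙_ C ⟶ B) (f : A ⟶ A')
    (g : B ⟶ B') : tensorState ρ σ ≫ (f ⊗ₘ g) = tensorState (ρ ≫ f) (σ ≫ g) := by
  simp [tensorState]

lemma tensorHom_tensorEffect {A A' B B' : C} (f : A ⟶ A') (g : B ⟶ B') (π : A' ⟶ 𝟙_ C)
    (κ : B' ⟶ 𝟙_ C) : (f ⊗ₘ g) ≫ tensorEffect π κ = tensorEffect (f ≫ π) (g ≫ κ) := by
  simp [tensorEffect]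

lemma tensorState_assoc {A B D : C} (ρ : 𝟙_ C ⟶ A) (σ : 𝟙_ C ⟶ B) (τ : 𝟙_ C ⟶ D) :
    tensorState (tensorState ρ σ) τ ≫ (α_ A B D).hom = tensorState ρ (tensorState σ τ) := by
  simp only [tensorState, Category.assoc]
  have h : (((λ_ (𝟙_ C)).inv ≫ (ρ ⊗ₘ σ)) ⊗ₘ τ) =
      ((λ_ (𝟙_ C)).inv ▷ (𝟙_ C)) ≫ ((ρ ⊗ₘ σ) ⊗ₘ τ) := by
    rw [← tensorHom_id, tensorHom_comp_tensorHom, Category.id_comp]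
  have h' : (ρ ⊗ₘ ((λ_ (𝟙_ C)).inv ≫ (σ ⊗ₘ τ))) =
      ((𝟙_ C) ◁ (λ_ (𝟙_ C)).inv) ≫ (ρ ⊗ₘ (σ ⊗ₘ τ)) := by
    rw [← id_tensorHom, tensorHom_comp_tensorHom, Category.id_comp]
  rw [h, h', Category.assoc, associator_naturality]
  simp only [← Category.assoc]
  congr 1
  monoidal

lemma tensorHom_scalar (s t : 𝟙_ C ⟶ 𝟙_ C) :
    (s ⊗ₘ t) ≫ (λ_ (𝟙_ C)).hom = (λ_ (𝟙_ C)).hom ≫ s ≫ t := by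
  rw [MonoidalCategory.tensorHom_def, Category.assoc, leftUnitor_naturality, unitors_equal,
    rightUnitor_naturality_assoc]

lemma tensorState_tensorEffect {A B : C} (ρ : 𝟙_ C ⟶ A) (σ : 𝟙_ C ⟶ B) (π : A ⟶ 𝟙_ C)
    (κ : B ⟶ 𝟙_ C) : tensorState ρ σ ≫ tensorEffect π κ = (ρ ≫ π) ≫ (σ ≫ κ) := by
  rw [tensorState, tensorEffect, Category.assoc, tensorHom_comp_tensorHom_assoc,
    tensorHom_scalar, Iso.inv_hom_id_assoc]

lemma tensorState_comp_scalar {A B : C} (s t : 𝟙_ C ⟶ 𝟙_ C) (ρ : 𝟙_ C ⟶ A) (σ : 𝟙_ C ⟶ B) :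
    tensorState (s ≫ ρ) (t ≫ σ) = (s ≫ t) ≫ tensorState ρ σ := by
  have h : (λ_ (𝟙_ C)).inv ≫ (s ⊗ₘ t) = (s ≫ t) ≫ (λ_ (𝟙_ C)).inv := by
    rw [Iso.eq_comp_inv, Category.assoc, tensorHom_scalar, Iso.inv_hom_id_assoc]
  rw [tensorState, tensorState, ← tensorHom_comp_tensorHom, ← Category.assoc, h, Category.assoc]

lemma subset_bidual {A : C} (c : Set (𝟙_ C ⟶ A)) : c ⊆ bidual c :=
  fun ρ hρ _ hπ => hπ ρ hρ

lemma dualEffects_bidual {A : C} (c : Set (𝟙_ C ⟶ A)) :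
    dualEffects (bidual c) = dualEffects c :=
  Set.Subset.antisymm (fun _ hπ ρ hρ => hπ ρ (subset_bidual c hρ)) (fun _ hπ _ hρ => hρ _ hπ)

lemma isClosedSet_dualStates {A : C} (e : Set (A ⟶ 𝟙_ C)) : IsClosedSet (dualStates e) :=
  Set.Subset.antisymm (fun _ hρ π hπ => hρ π (fun _ hσ => hσ π hπ)) (subset_bidual _)

lemma isClosedSet_unit : IsClosedSet ({𝟙 (𝟙_ C)} : Set (𝟙_ C ⟶ 𝟙_ C)) := by
  refine Set.Subset.antisymm (fun ρ hρ => ?_) (subset_bidual _)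
  have := hρ (𝟙 _) (by rintro σ rfl; simp)
  simpa using this

lemma bidual_map {A B : C} (h : A ⟶ B) {S : Set (𝟙_ C ⟶ A)} {c : Set (𝟙_ C ⟶ B)}
    (hc : IsClosedSet c) (H : ∀ ρ ∈ S, ρ ≫ h ∈ c) : ∀ ω ∈ bidual S, ω ≫ h ∈ c := by
  intro ω hω
  rw [← hc]
  intro π hπ
  rw [Category.assoc]
  exact hω _ (fun ρ hρ => by rw [← Category.assoc]; exact hπ _ (H ρ hρ))

lemma isClosedSet_tensorSet {A B : C} (c₁ : Set (𝟙_ C ⟶ A)) (c₂ : Set (𝟙_ C ⟶ B)) :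
    IsClosedSet (tensorSet c₁ c₂) := isClosedSet_dualStates _

lemma tensorState_mem {A B : C} {c₁ : Set (𝟙_ C ⟶ A)} {c₂ : Set (𝟙_ C ⟶ B)} {ρ : 𝟙_ C ⟶ A}
    {σ : 𝟙_ C ⟶ B} (hρ : ρ ∈ c₁) (hσ : σ ∈ c₂) : tensorState ρ σ ∈ tensorSet c₁ c₂ :=
  subset_bidual _ (Set.mem_image2_of_mem hρ hσ)

lemma parSet_map {A A' B B' : C} {c₁ : Set (𝟙_ C ⟶ A)} {c₁' : Set (𝟙_ C ⟶ A')}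
    {c₂ : Set (𝟙_ C ⟶ B)} {c₂' : Set (𝟙_ C ⟶ B')} {f : A ⟶ A'} {g : B ⟶ B'}
    (hf : ∀ ρ ∈ c₁, ρ ≫ f ∈ c₁') (hg : ∀ ρ ∈ c₂, ρ ≫ g ∈ c₂') :
    ∀ ω ∈ parSet c₁ c₂, ω ≫ (f ⊗ₘ g) ∈ parSet c₁' c₂' := by
  rintro ω hω _ ⟨π, hπ, κ, hκ, rfl⟩
  rw [Category.assoc, tensorHom_tensorEffect]
  refine hω _ (Set.mem_image2_of_mem (fun ρ hρ => ?_) (fun ρ hρ => ?_))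
  · rw [← Category.assoc]; exact hπ _ (hf _ hρ)
  · rw [← Category.assoc]; exact hκ _ (hg _ hρ)

lemma tensorSet_map {A B D : C} (h : A ⊗ B ⟶ D) {c₁ : Set (𝟙_ C ⟶ A)} {c₂ : Set (𝟙_ C ⟶ B)}
    {c : Set (𝟙_ C ⟶ D)} (hc : IsClosedSet c)
    (H : ∀ ρ ∈ c₁, ∀ σ ∈ c₂, tensorState ρ σ ≫ h ∈ c) :
    ∀ ω ∈ tensorSet c₁ c₂, ω ≫ h ∈ c := by
  refine bidual_map h hc ?_
  rintro _ ⟨ρ, hρ, σ, hσ, rfl⟩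
  exact H ρ hρ σ hσ

lemma tensorSet_map_tensorHom {A A' B B' : C} {c₁ : Set (𝟙_ C ⟶ A)} {c₁' : Set (𝟙_ C ⟶ A')}
    {c₂ : Set (𝟙_ C ⟶ B)} {c₂' : Set (𝟙_ C ⟶ B')} {f : A ⟶ A'} {g : B ⟶ B'}
    (hf : ∀ ρ ∈ c₁, ρ ≫ f ∈ c₁') (hg : ∀ ρ ∈ c₂, ρ ≫ g ∈ c₂') :
    ∀ ω ∈ tensorSet c₁ c₂, ω ≫ (f ⊗ₘ g) ∈ tensorSet c₁' c₂' :=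
  tensorSet_map _ (isClosedSet_tensorSet _ _) (fun ρ hρ σ hσ => by
    rw [tensorState_tensorHom]
    exact tensorState_mem (hf _ hρ) (hg _ hσ))

lemma tensorSet_associator {A B D : C} (c₁ : Set (𝟙_ C ⟶ A)) (c₂ : Set (𝟙_ C ⟶ B))
    (c₃ : Set (𝟙_ C ⟶ D)) : ∀ ω ∈ tensorSet (tensorSet c₁ c₂) c₃,
    ω ≫ (α_ A B D).hom ∈ tensorSet c₁ (tensorSet c₂ c₃) := by
  refine tensorSet_map _ (isClosedSet_tensorSet _ _) (fun ω hω τ hτ => ?_)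
  rw [← comp_addRight, Category.assoc]
  refine tensorSet_map _ (isClosedSet_tensorSet _ _) (fun ρ hρ σ hσ => ?_) ω hω
  rw [← Category.assoc, comp_addRight, tensorState_assoc]
  exact tensorState_mem hρ (tensorState_mem hσ hτ)

lemma tensorSet_associator_inv {A B D : C} (c₁ : Set (𝟙_ C ⟶ A)) (c₂ : Set (𝟙_ C ⟶ B))
    (c₃ : Set (𝟙_ C ⟶ D)) : ∀ ω ∈ tensorSet c₁ (tensorSet c₂ c₃),
    ω ≫ (α_ A B D).inv ∈ tensorSet (tensorSet c₁ c₂) c₃ := by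
  refine tensorSet_map _ (isClosedSet_tensorSet _ _) (fun ρ hρ ω hω => ?_)
  rw [← comp_addLeft, Category.assoc]
  refine tensorSet_map _ (isClosedSet_tensorSet _ _) (fun σ hσ τ hτ => ?_) ω hω
  rw [← Category.assoc, comp_addLeft, ← tensorState_assoc, Category.assoc, Iso.hom_inv_id,
    Category.comp_id]
  exact tensorState_mem (tensorState_mem hρ hσ) hτ

lemma tensorSet_leftUnitor {A : C} {c : Set (𝟙_ C ⟶ A)} (hc : IsClosedSet c) :
    ∀ ω ∈ tensorSet {𝟙 (𝟙_ C)} c, ω ≫ (λ_ A).hom ∈ c := by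
  refine tensorSet_map _ hc ?_
  rintro ρ rfl σ hσ
  rw [← comp_addLeft]
  simpa [addLeft] using hσ

lemma tensorSet_leftUnitor_inv {A : C} (c : Set (𝟙_ C ⟶ A)) :
    ∀ ω ∈ c, ω ≫ (λ_ A).inv ∈ tensorSet {𝟙 (𝟙_ C)} c := by
  intro ω hω
  have h := tensorState_mem (c₁ := {𝟙 (𝟙_ C)}) rfl hω
  rw [← comp_addLeft] at h
  simpa [addLeft] using h

lemma tensorSet_rightUnitor {A : C} {c : Set (𝟙_ C ⟶ A)} (hc : IsClosedSet c) :
    ∀ ω ∈ tensorSet c {𝟙 (𝟙_ C)}, ω ≫ (ρ_ A).hom ∈ c := by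
  refine tensorSet_map _ hc ?_
  rintro ρ hρ σ rfl
  rw [← comp_addRight]
  simpa [addRight] using hρ

lemma tensorSet_rightUnitor_inv {A : C} (c : Set (𝟙_ C ⟶ A)) :
    ∀ ω ∈ c, ω ≫ (ρ_ A).inv ∈ tensorSet c {𝟙 (𝟙_ C)} := by
  intro ω hω
  have h := tensorState_mem (c₂ := {𝟙 (𝟙_ C)}) hω rfl
  rw [← comp_addRight] at h
  simpa [addRight] using h

lemma parSet_distributor {A B D : C} (c₁ : Set (𝟙_ C ⟶ A)) (c₂ : Set (𝟙_ C ⟶ B))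
    (c₃ : Set (𝟙_ C ⟶ D)) : ∀ ω ∈ tensorSet (parSet c₁ c₂) c₃,
    ω ≫ (α_ A B D).hom ∈ parSet c₁ (tensorSet c₂ c₃) := by
  refine tensorSet_map _ (isClosedSet_dualStates _) (fun ω hω τ hτ => ?_)
  rintro _ ⟨π, hπ, κ, hκ, rfl⟩
  have h : addRight (A ⊗ B) τ ≫ (α_ A B D).hom = 𝟙 A ⊗ₘ addRight B τ := by
    simp [addRight]
  rw [← comp_addRight, Category.assoc ω, h, Category.assoc, tensorHom_tensorEffect,
    Category.id_comp]
  refine hω _ (Set.mem_image2_of_mem hπ (fun ρ hρ => ?_))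
  rw [← Category.assoc, comp_addRight]
  exact hκ _ (tensorState_mem hρ hτ)

lemma strength_natural {A B B' X Z X' Z' Y Y' : C} (a : X' ⟶ X) (p : X ⟶ A ⊗ B) (b : B ⟶ B')
    (x : Z' ⟶ Z) (f : Z ⟶ Y) (y : Y ⟶ Y') :
    ((a ≫ p ≫ (𝟙 A ⊗ₘ b)) ⊗ₘ (x ≫ f ≫ y)) ≫ (α_ A B' Y').hom =
      (a ⊗ₘ x) ≫ ((p ⊗ₘ f) ≫ (α_ A B Y).hom) ≫ (𝟙 A ⊗ₘ (b ⊗ₘ y)) := by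
  rw [← tensorHom_comp_tensorHom, ← tensorHom_comp_tensorHom]
  simp only [Category.assoc]
  rw [associator_naturality]

lemma strength_unit {A B X : C} (p : X ⟶ A ⊗ B) :
    (ρ_ X).inv ≫ ((p ⊗ₘ 𝟙 (𝟙_ C)) ≫ (α_ A B (𝟙_ C)).hom) ≫ (𝟙 A ⊗ₘ (ρ_ B).hom) = p := by
  simp

lemma strength_assoc {A B X Y Z V W : C} (p : X ⟶ A ⊗ B) (f : Z ⟶ Y) (g : V ⟶ W) :
    (α_ X Z V).inv ≫ ((((p ⊗ₘ f) ≫ (α_ A B Y).hom) ⊗ₘ g) ≫ (α_ A (B ⊗ Y) W).hom) ≫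
        (𝟙 A ⊗ₘ (α_ B Y W).hom) =
      (p ⊗ₘ (f ⊗ₘ g)) ≫ (α_ A B (Y ⊗ W)).hom := by
  have h : (((p ⊗ₘ f) ≫ (α_ A B Y).hom) ⊗ₘ g) = ((p ⊗ₘ f) ⊗ₘ g) ≫ ((α_ A B Y).hom ▷ W) := by
    rw [← tensorHom_id, tensorHom_comp_tensorHom, Category.comp_id]
  rw [h]
  simp only [Category.assoc, id_tensorHom, pentagon]
  rw [associator_naturality_assoc, Iso.inv_hom_id_assoc]

lemma strength_map {A A' B X Y Z : C} (p : X ⟶ A ⊗ B) (f : A ⟶ A') (g : Z ⟶ Y) :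
    ((p ⊗ₘ g) ≫ (α_ A B Y).hom) ≫ (f ⊗ₘ 𝟙 (B ⊗ Y)) =
      ((p ≫ (f ⊗ₘ 𝟙 B)) ⊗ₘ g) ≫ (α_ A' B Y).hom := by
  have h : ((p ≫ (f ⊗ₘ 𝟙 B)) ⊗ₘ g) = (p ⊗ₘ g) ≫ ((f ⊗ₘ 𝟙 B) ⊗ₘ 𝟙 Y) := by
    rw [tensorHom_comp_tensorHom, Category.comp_id]
  rw [h]
  simp only [Category.assoc]
  rw [associator_naturality]
  simp

end States

/-! ### The Caus-construction -/

section CausConstruction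

variable (C : Type u) [Category.{v} C] [MonoidalCategory C] [RightRigidCategory C]
  [EnvironmentStructure C]

/-- Objects of `Caus(C)`: objects of `C` with a flat and closed set of states. -/
structure Caus where
  /-- the underlying object -/
  obj : C
  /-- the set of states -/
  states : Set (𝟙_ C ⟶ obj)
  flat : IsFlatSet states
  closed : IsClosedSet states

variable {C}

/-- Morphisms of `Caus(C)`: morphisms of `C` that send chosen states to chosen states. -/
@[ext]
structure Caus.Hom (X Y : Caus C) where
  /-- the underlying morphism -/
  hom : X.obj ⟶ Y.obj
  map_mem : ∀ ρ ∈ X.states, ρ ≫ hom ∈ Y.states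

instance : Category (Caus C) where
  Hom := Caus.Hom
  id X := ⟨𝟙 X.obj, fun ρ hρ => by simpa using hρ⟩
  comp f g := ⟨f.hom ≫ g.hom, fun ρ hρ => by
    rw [← Category.assoc]; exact g.map_mem _ (f.map_mem _ hρ)⟩

namespace Caus

@[simp] lemma id_hom (X : Caus C) : Hom.hom (𝟙 X) = 𝟙 X.obj := rfl

@[simp] lemma comp_hom {X Y Z : Caus C} (f : X ⟶ Y) (g : Y ⟶ Z) :
    Hom.hom (f ≫ g) = f.hom ≫ g.hom := rfl

@[ext] lemma hom_ext {X Y : Caus C} {f g : X ⟶ Y} (h : f.hom = g.hom) : f = g := Hom.ext h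

/-- The forgetful functor `Caus(C) ⥤ C`. -/
def forget : Caus C ⥤ C where
  obj X := X.obj
  map f := f.hom

instance : (forget (C := C)).Faithful where
  map_injective h := hom_ext h

/-- Build an isomorphism of `Caus(C)` from one of `C`. -/
def isoMk {X Y : Caus C} (e : X.obj ≅ Y.obj) (h : ∀ ρ ∈ X.states, ρ ≫ e.hom ∈ Y.states)
    (h' : ∀ ρ ∈ Y.states, ρ ≫ e.inv ∈ X.states) : X ≅ Y where
  hom := ⟨e.hom, h⟩
  inv := ⟨e.inv, h'⟩

/-- The first-order objects: those `X` such that `c_X*` is a singleton. -/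
def IsFirstOrder : ObjectProperty (Caus C) := fun X => ∃ π, dualEffects X.states = {π}

end Caus

end CausConstruction

namespace Caus

variable {C : Type u} [Category.{v} C] [MonoidalCategory C] [SymmetricCategory C]
  [RightRigidCategory C] [PrecausalCategory C]

lemma tensorEffect_discard {A B : C} (s t : 𝟙_ C ⟶ 𝟙_ C) :
    tensorEffect (ground A ≫ s) (ground B ≫ t) = ground (A ⊗ B) ≫ s ≫ t := by
  rw [show ground (A ⊗ B) = (ground A ⊗ₘ ground B) ≫ (λ_ (𝟙_ C)).hom from
    EnvironmentStructure.discard_tensor A B, tensorEffect, ← tensorHom_comp_tensorHom,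
    Category.assoc, tensorHom_scalar, Category.assoc]

lemma tensorState_uniform {A B : C} (s t : 𝟙_ C ⟶ 𝟙_ C) :
    tensorState (s ≫ uniform A) (t ≫ uniform B) = (s ≫ t) ≫ uniform (A ⊗ B) := by
  rw [PrecausalCategory.uniform_tensor, tensorState_comp_scalar, tensorState]

lemma isFlatSet_unit : IsFlatSet {𝟙 (𝟙_ C)} := by
  refine ⟨?_, 𝟙 _, inferInstance, ?_⟩
  · by_cases h : Limits.IsZero (𝟙_ C)
    · exact ⟨𝟙 _, inferInstance, h.eq_of_src _ _⟩
    · have h1 : IsIso (uniform (𝟙_ C) ≫ ground (𝟙_ C)) :=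
        PrecausalCategory.dim_invertible (𝟙_ C) h
      rw [show ground (𝟙_ C) = 𝟙 _ from EnvironmentStructure.discard_unit,
        Category.comp_id] at h1
      exact ⟨inv (uniform (𝟙_ C)), inferInstance, by simp⟩
  · rintro ρ rfl
    simp [show ground (𝟙_ C) = 𝟙 _ from EnvironmentStructure.discard_unit]

lemma isFlatSet_tensorSet {A B : C} {c₁ : Set (𝟙_ C ⟶ A)} {c₂ : Set (𝟙_ C ⟶ B)}
    (h₁ : IsFlatSet c₁) (h₂ : IsFlatSet c₂) : IsFlatSet (tensorSet c₁ c₂) := by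
  obtain ⟨⟨s₁, _, hs₁⟩, t₁, _, ht₁⟩ := h₁
  obtain ⟨⟨s₂, _, hs₂⟩, t₂, _, ht₂⟩ := h₂
  refine ⟨⟨s₁ ≫ s₂, inferInstance, ?_⟩, t₁ ≫ t₂, inferInstance, ?_⟩
  · rw [← tensorState_uniform]
    exact tensorState_mem hs₁ hs₂
  · rw [← tensorEffect_discard, tensorSet, dualEffects_bidual]
    rintro _ ⟨ρ, hρ, σ, hσ, rfl⟩
    rw [tensorState_tensorEffect, ht₁ _ hρ, ht₂ _ hσ, Category.comp_id]

lemma isFlatSet_parSet {A B : C} {c₁ : Set (𝟙_ C ⟶ A)} {c₂ : Set (𝟙_ C ⟶ B)}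
    (h₁ : IsFlatSet c₁) (h₂ : IsFlatSet c₂) : IsFlatSet (parSet c₁ c₂) := by
  obtain ⟨⟨s₁, _, hs₁⟩, t₁, _, ht₁⟩ := h₁
  obtain ⟨⟨s₂, _, hs₂⟩, t₂, _, ht₂⟩ := h₂
  refine ⟨⟨s₁ ≫ s₂, inferInstance, ?_⟩, t₁ ≫ t₂, inferInstance, ?_⟩
  · rw [← tensorState_uniform]
    rintro _ ⟨π, hπ, κ, hκ, rfl⟩
    rw [tensorState_tensorEffect, hπ _ hs₁, hκ _ hs₂, Category.comp_id]
  · rw [← tensorEffect_discard]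
    exact fun ρ hρ => hρ _ (Set.mem_image2_of_mem ht₁ ht₂)

/-- The unit object `I` of `Caus(C)`. -/
def unitObj : Caus C := ⟨𝟙_ C, {𝟙 _}, isFlatSet_unit, isClosedSet_unit⟩

/-- The tensor product of `Caus(C)`. -/
def tensor (X Y : Caus C) : Caus C :=
  ⟨X.obj ⊗ Y.obj, tensorSet X.states Y.states, isFlatSet_tensorSet X.flat Y.flat,
    isClosedSet_tensorSet _ _⟩

/-- The par product of `Caus(C)`. -/
def par (X Y : Caus C) : Caus C :=
  ⟨X.obj ⊗ Y.obj, parSet X.states Y.states, isFlatSet_parSet X.flat Y.flat,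
    isClosedSet_dualStates _⟩

/-- The par product of morphisms. -/
def parHom {X X' Y Y' : Caus C} (f : X ⟶ X') (g : Y ⟶ Y') : par X Y ⟶ par X' Y' :=
  ⟨f.hom ⊗ₘ g.hom, parSet_map f.map_mem g.map_mem⟩

/-- The tensor product of morphisms. -/
def tensorMap {X X' Y Y' : Caus C} (f : X ⟶ X') (g : Y ⟶ Y') : tensor X Y ⟶ tensor X' Y' :=
  ⟨f.hom ⊗ₘ g.hom, tensorSet_map_tensorHom f.map_mem g.map_mem⟩

instance : MonoidalCategoryStruct (Caus C) where
  tensorObj := tensor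
  tensorUnit := unitObj
  tensorHom f g := tensorMap f g
  whiskerLeft X _ _ f := tensorMap (𝟙 X) f
  whiskerRight f Y := tensorMap f (𝟙 Y)
  associator X Y Z := isoMk (X := tensor (tensor X Y) Z) (Y := tensor X (tensor Y Z))
    (α_ X.obj Y.obj Z.obj) (tensorSet_associator _ _ _) (tensorSet_associator_inv _ _ _)
  leftUnitor X := isoMk (X := tensor unitObj X) (λ_ X.obj) (tensorSet_leftUnitor X.closed)
    (tensorSet_leftUnitor_inv _)
  rightUnitor X := isoMk (X := tensor X unitObj) (ρ_ X.obj) (tensorSet_rightUnitor X.closed)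
    (tensorSet_rightUnitor_inv _)

/-- The monoidal structure of `Caus(C)`, with the structure morphisms of `C`. -/
instance : MonoidalCategory (Caus C) :=
  Monoidal.induced (forget (C := C))
    { μIso := fun _ _ => Iso.refl _
      εIso := Iso.refl _
      whiskerLeft_eq := fun X _ _ f => by
        change (𝟙 X.obj ⊗ₘ f.hom) = 𝟙 _ ≫ (X.obj ◁ f.hom) ≫ 𝟙 _
        simp
      whiskerRight_eq := fun f Y => by
        change (f.hom ⊗ₘ 𝟙 Y.obj) = 𝟙 _ ≫ (f.hom ▷ Y.obj) ≫ 𝟙 _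
        simp
      tensorHom_eq := fun f g => by
        change (f.hom ⊗ₘ g.hom) = 𝟙 _ ≫ (f.hom ⊗ₘ g.hom) ≫ 𝟙 _
        simp
      associator_eq := fun X Y Z => by
        change (α_ X.obj Y.obj Z.obj).hom = (𝟙 _ ≫ (𝟙 (X.obj ⊗ Y.obj) ⊗ₘ 𝟙 Z.obj)) ≫
          (α_ X.obj Y.obj Z.obj).hom ≫ (𝟙 X.obj ⊗ₘ 𝟙 (Y.obj ⊗ Z.obj)) ≫ 𝟙 _
        simp
      leftUnitor_eq := fun X => by
        change (λ_ X.obj).hom = (𝟙 _ ≫ (𝟙 (𝟙_ C) ⊗ₘ 𝟙 X.obj)) ≫ (λ_ X.obj).hom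
        simp
      rightUnitor_eq := fun X => by
        change (ρ_ X.obj).hom = (𝟙 _ ≫ (𝟙 X.obj ⊗ₘ 𝟙 (𝟙_ C))) ≫ (ρ_ X.obj).hom
        simp }

lemma parHom_id (X Y : Caus C) : parHom (𝟙 X) (𝟙 Y) = 𝟙 (par X Y) :=
  hom_ext (id_tensorHom_id X.obj Y.obj)

lemma parHom_comp {X X' X'' Y Y' Y'' : Caus C} (f : X ⟶ X') (f' : X' ⟶ X'') (g : Y ⟶ Y')
    (g' : Y' ⟶ Y'') : parHom (f ≫ f') (g ≫ g') = parHom f g ≫ parHom f' g' :=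
  hom_ext (tensorHom_comp_tensorHom f.hom g.hom f'.hom g'.hom).symm

/-- The linear distributor `(A ⅋ X) ⊗ Y ⟶ A ⅋ (X ⊗ Y)`, given by the associator of `C`. -/
def distributor (A X Y : Caus C) : par A X ⊗ Y ⟶ par A (X ⊗ Y) :=
  ⟨(α_ A.obj X.obj Y.obj).hom, parSet_distributor _ _ _⟩

/-! ### First-order objects -/

lemma dualEffects_eq_of_isFirstOrder {X : Caus C} (hX : IsFirstOrder X) :
    ∃ t : 𝟙_ C ⟶ 𝟙_ C, IsIso t ∧ dualEffects X.states = {ground X.obj ≫ t} := by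
  obtain ⟨π, hπ⟩ := hX
  obtain ⟨-, t, ht, hm⟩ := X.flat
  refine ⟨t, ht, ?_⟩
  rw [hπ] at hm ⊢
  rw [Set.mem_singleton_iff.1 hm]

/-- Effects on a tensor product are separated by products of causal states. -/
lemma effect_ext {A B : C} (f g : A ⊗ B ⟶ 𝟙_ C)
    (h : ∀ ρ : 𝟙_ C ⟶ A, Causal ρ → ∀ σ : 𝟙_ C ⟶ B, Causal σ →
      tensorState ρ σ ≫ f = tensorState ρ σ ≫ g) : f = g := by
  apply (tensorRightHomEquiv A B (Bᘁ) (𝟙_ C)).injective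
  apply PrecausalCategory.enough_causal_states
  intro ρ hρ
  apply (tensorRightHomEquiv (𝟙_ C) B (Bᘁ) (𝟙_ C)).symm.injective
  rw [tensorRightHomEquiv_symm_naturality, tensorRightHomEquiv_symm_naturality,
    Equiv.symm_apply_apply, Equiv.symm_apply_apply]
  have h1 : addLeft ρ B ≫ f = addLeft ρ B ≫ g := by
    apply PrecausalCategory.enough_causal_states
    intro σ hσ
    rw [← Category.assoc, ← Category.assoc, comp_addLeft]
    exact h ρ hρ σ hσ
  simp only [addLeft, Category.assoc] at h1
  exact (cancel_epi (λ_ B).inv).1 h1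

lemma isFirstOrder_unit : IsFirstOrder (𝟙_ (Caus C)) := by
  refine ⟨𝟙 (𝟙_ C), Set.Subset.antisymm (fun π hπ => ?_) ?_⟩
  · have : 𝟙 (𝟙_ C) ≫ (show 𝟙_ C ⟶ 𝟙_ C from π) = 𝟙 (𝟙_ C) := hπ (𝟙 _) rfl
    rw [Category.id_comp] at this
    exact this
  · rintro _ rfl ρ rfl
    exact Category.id_comp (𝟙 (𝟙_ C))

lemma causal_comp_inv_mem {X : Caus C} {t : 𝟙_ C ⟶ 𝟙_ C} [IsIso t]
    (ht : dualEffects X.states = {ground X.obj ≫ t}) {ρ : 𝟙_ C ⟶ X.obj} (hρ : Causal ρ) :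
    inv t ≫ ρ ∈ X.states := by
  rw [← X.closed, bidual, ht]
  rintro _ rfl
  have h : ρ ≫ ground X.obj = 𝟙 _ :=
    hρ.trans EnvironmentStructure.discard_unit
  rw [Category.assoc, reassoc_of% h, IsIso.inv_hom_id]

lemma isFirstOrder_tensor {X Y : Caus C} (hX : IsFirstOrder X) (hY : IsFirstOrder Y) :
    IsFirstOrder (X ⊗ Y) := by
  obtain ⟨s, hs, hs'⟩ := dualEffects_eq_of_isFirstOrder hX
  obtain ⟨t, ht, ht'⟩ := dualEffects_eq_of_isFirstOrder hY
  suffices H : dualEffects (tensorSet X.states Y.states) =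
      {tensorEffect (ground X.obj ≫ s) (ground Y.obj ≫ t)} from ⟨_, H⟩
  have hmem : tensorEffect (ground X.obj ≫ s) (ground Y.obj ≫ t) ∈
      dualEffects (tensorSet X.states Y.states) := by
    rw [tensorSet, dualEffects_bidual]
    rintro _ ⟨ρ, hρ, σ, hσ, rfl⟩
    have h1 : ground X.obj ≫ s ∈ dualEffects X.states := by rw [hs']; rfl
    have h2 : ground Y.obj ≫ t ∈ dualEffects Y.states := by rw [ht']; rfl
    rw [tensorState_tensorEffect, h1 _ hρ, h2 _ hσ, Category.comp_id]
  refine Set.Subset.antisymm (fun w hw => ?_) (Set.singleton_subset_iff.2 hmem)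
  refine effect_ext _ _ (fun ρ hρ σ hσ => ?_)
  have h3 : tensorState (inv s ≫ ρ) (inv t ≫ σ) ∈ tensorSet X.states Y.states :=
    tensorState_mem (causal_comp_inv_mem hs' hρ) (causal_comp_inv_mem ht' hσ)
  have h5 := (hw _ h3).trans (hmem _ h3).symm
  rw [tensorState_comp_scalar, Category.assoc (inv s ≫ inv t),
    Category.assoc (inv s ≫ inv t)] at h5
  exact (cancel_epi (inv s ≫ inv t)).1 h5

instance : (IsFirstOrder (C := C)).IsMonoidal where
  prop_unit := isFirstOrder_unit
  prop_tensor _ _ h₁ h₂ := isFirstOrder_tensor h₁ h₂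

variable (C) in
/-- The category `C₁` of first-order causal processes: the full subcategory of `Caus(C)` on the
first-order objects, with the tensor product of `Caus(C)`. -/
abbrev FirstOrder := (IsFirstOrder (C := C)).FullSubcategory

/-! ### The embedding -/

/-- The strong profunctor `F(A)(X, X') = Caus(C)(X, A ⅋ X')` on `C₁`, on which `C₁` acts by
composition, with strength `(φ, f) ↦ (φ ⊗ f) ≫ distributor`. -/
def embObj (A : Caus C) : StrongProfunctor.{v} (FirstOrder C) where
  P :=
    { obj := fun XX => XX.1.unop.obj ⟶ par A XX.2.obj
      map := fun g => TypeCat.ofHom fun φ => g.1.unop.hom ≫ φ ≫ parHom (𝟙 A) g.2.hom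
      map_id := fun XX => by
        refine ConcreteCategory.hom_ext _ _ (fun φ => ?_)
        change 𝟙 _ ≫ φ ≫ parHom (𝟙 A) (𝟙 XX.2.obj) = φ
        rw [parHom_id, Category.id_comp, Category.comp_id]
      map_comp := fun {XX YY ZZ} f g => by
        refine ConcreteCategory.hom_ext _ _ (fun φ => ?_)
        change (g.1.unop.hom ≫ f.1.unop.hom) ≫ φ ≫ parHom (𝟙 A) (f.2.hom ≫ g.2.hom) =
          g.1.unop.hom ≫ (f.1.unop.hom ≫ φ ≫ parHom (𝟙 A) f.2.hom) ≫ parHom (𝟙 A) g.2.hom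
        rw [← Category.id_comp (𝟙 A), parHom_comp]
        simp only [Category.assoc, Category.id_comp] }
  str := fun φ f => (φ ⊗ₘ f.hom) ≫ distributor A _ _
  str_natural := fun a b x y p f =>
    hom_ext (strength_natural a.hom.hom (Hom.hom p) b.hom.hom x.hom.hom f.hom.hom y.hom.hom)
  str_unit := fun p => hom_ext (strength_unit (Hom.hom p))
  str_assoc := fun p f g => hom_ext (strength_assoc (Hom.hom p) f.hom.hom g.hom.hom)

/-- The functor `F : Caus(C) ⥤ StProf(C₁)`, with `F(f)` given by composition with `f ⅋ X'`. -/
def emb : Caus C ⥤ StrongProfunctor.{v} (FirstOrder C) where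
  obj := embObj
  map {A B} f :=
    { nat :=
        { app := fun XX => TypeCat.ofHom fun φ => φ ≫ parHom f (𝟙 XX.2.obj)
          naturality := fun XX YY g => by
            refine ConcreteCategory.hom_ext _ _ (fun (φ : XX.1.unop.obj ⟶ par A XX.2.obj) => ?_)
            change (g.1.unop.hom ≫ φ ≫ parHom (𝟙 A) g.2.hom) ≫ parHom f (𝟙 YY.2.obj) =
              g.1.unop.hom ≫ (φ ≫ parHom f (𝟙 XX.2.obj)) ≫ parHom (𝟙 B) g.2.hom
            simp only [Category.assoc, ← parHom_comp, Category.id_comp, Category.comp_id] }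
      nat_str := fun p g => hom_ext (strength_map (Hom.hom p) f.hom g.hom.hom) }
  map_id A := by
    apply StrongNatTrans.ext
    ext XX : 2
    refine ConcreteCategory.hom_ext _ _ (fun (φ : XX.1.unop.obj ⟶ par A XX.2.obj) => ?_)
    change φ ≫ parHom (𝟙 A) (𝟙 XX.2.obj) = φ
    rw [parHom_id, Category.comp_id]
  map_comp {A B D} f g := by
    apply StrongNatTrans.ext
    ext XX : 2
    refine ConcreteCategory.hom_ext _ _ (fun (φ : XX.1.unop.obj ⟶ par A XX.2.obj) => ?_)
    change φ ≫ parHom (f ≫ g) (𝟙 XX.2.obj) =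
      (φ ≫ parHom f (𝟙 XX.2.obj)) ≫ parHom g (𝟙 XX.2.obj)
    rw [Category.assoc, ← parHom_comp, Category.id_comp]

end Caus

namespace Caus

section

variable {C : Type u} [Category.{v} C] [MonoidalCategory C] [RightRigidCategory C]

/-- If the dual of `A` is a zero object, then there is at most one morphism out of `A`. -/
lemma hom_eq_of_isZero_dual {A B : C} (h : Limits.IsZero (Aᘁ)) (f g : A ⟶ B) : f = g := by
  apply (cancel_epi (λ_ A).hom).1
  apply (tensorRightHomEquiv (𝟙_ C) A (Aᘁ) B).injective
  apply (tensorLeftHomEquiv (𝟙_ C) B (Bᘁ) (Aᘁ)).symm.injective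
  exact h.eq_of_tgt _ _

/-- A morphism out of `A` is determined by its action on one half of the cup of `A`. -/
lemma eq_of_coevaluation_comp {A B : C} {f g : A ⟶ B}
    (h : η_ A (Aᘁ) ≫ f ▷ (Aᘁ) = η_ A (Aᘁ) ≫ g ▷ (Aᘁ)) : f = g := by
  apply (cancel_epi (λ_ A).hom).1
  apply (tensorRightHomEquiv (𝟙_ C) A (Aᘁ) B).injective
  have key : ∀ k : A ⟶ B, tensorRightHomEquiv (𝟙_ C) A (Aᘁ) B ((λ_ A).hom ≫ k) =
      η_ A (Aᘁ) ≫ k ▷ (Aᘁ) := fun k => by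
    rw [tensorRightHomEquiv_naturality]
    congr 1
    simp [tensorRightHomEquiv, ← unitors_inv_equal]
  rw [key, key, h]

/-- Applying an effect to the first half of the cup and discarding the other half evaluates the
effect on the uniform state. -/
lemma coevaluation_tensorEffect [EnvironmentStructure C] {A : C} (π : A ⟶ 𝟙_ C)
    (s : 𝟙_ C ⟶ 𝟙_ C) :
    η_ A (Aᘁ) ≫ tensorEffect π (ground (Aᘁ) ≫ s) = (uniform A ≫ π) ≫ s := by
  have h : (π ⊗ₘ (ground (Aᘁ) ≫ s)) = A ◁ ground (Aᘁ) ≫ π ▷ (𝟙_ C) ≫ (𝟙 (𝟙_ C) ⊗ₘ s) := by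
    rw [← id_tensorHom, ← tensorHom_id, tensorHom_comp_tensorHom, tensorHom_comp_tensorHom]
    simp
  rw [tensorEffect, h, uniform]
  simp only [Category.assoc]
  rw [tensorHom_scalar, Category.id_comp, unitors_equal, rightUnitor_naturality_assoc]

end

variable {C : Type u} [Category.{v} C] [MonoidalCategory C] [SymmetricCategory C]
  [RightRigidCategory C] [PrecausalCategory C]

/-- The singleton of a rescaled discarding effect is a closed set of effects. -/
lemma dualEffects_dualStates_ground (A : C) (s : 𝟙_ C ⟶ 𝟙_ C) [IsIso s] :
    dualEffects (dualStates {ground A ≫ s}) = {ground A ≫ s} := by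
  refine Set.Subset.antisymm (fun π hπ => ?_)
    (Set.singleton_subset_iff.2 fun ρ hρ => hρ _ rfl)
  refine PrecausalCategory.enough_causal_states _ _ (fun ρ hρ => ?_)
  have h : ρ ≫ ground A = 𝟙 _ := hρ.trans EnvironmentStructure.discard_unit
  have hmem : inv s ≫ ρ ∈ dualStates {ground A ≫ s} := by
    rintro _ rfl
    rw [Category.assoc, reassoc_of% h, IsIso.inv_hom_id]
  have h' := hπ _ hmem
  rw [Category.assoc] at h'
  rw [reassoc_of% h, ← cancel_epi (inv s), h', IsIso.inv_hom_id]

/-- The first-order object on a nonzero object `A`, with discarding effect rescaled by `s`. -/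
def firstOrderObj (A : C) (hA : ¬ Limits.IsZero A) (s : 𝟙_ C ⟶ 𝟙_ C) [IsIso s] :
    FirstOrder C where
  obj :=
    { obj := A
      states := dualStates {ground A ≫ s}
      flat := by
        have := PrecausalCategory.dim_invertible A hA
        refine ⟨⟨inv ((uniform A ≫ ground A) ≫ s), inferInstance, ?_⟩, s, inferInstance, ?_⟩
        · rintro _ rfl
          have h := IsIso.inv_hom_id ((uniform A ≫ ground A) ≫ s)
          simpa only [Category.assoc] using h
        · rw [dualEffects_dualStates_ground]
          rfl
      closed := isClosedSet_dualStates _ }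
  property := ⟨_, dualEffects_dualStates_ground A s⟩

/-- The cup of `A` is a state of the par of `A` with a suitably rescaled first-order object. -/
lemma coevaluation_mem_parSet {A : C} {c : Set (𝟙_ C ⟶ A)} {s : 𝟙_ C ⟶ 𝟙_ C} [IsIso s]
    (hs : s ≫ uniform A ∈ c) :
    η_ A (Aᘁ) ∈ parSet c (dualStates {ground (Aᘁ) ≫ s}) := by
  rintro _ ⟨π, hπ, κ, hκ, rfl⟩
  rw [dualEffects_dualStates_ground] at hκ
  obtain rfl := hκ
  have h := hπ _ hs
  rw [Category.assoc] at h
  rw [coevaluation_tensorEffect, ← cancel_epi s, Category.assoc, reassoc_of% h, Category.comp_id]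

/-- The cup of `A`, as a morphism from the tensor unit to the par of `A` with a first-order
object. -/
def coevaluationPar (A : Caus C) (hA : ¬ Limits.IsZero (A.objᘁ)) (s : 𝟙_ C ⟶ 𝟙_ C) [IsIso s]
    (hs : s ≫ uniform A.obj ∈ A.states) :
    (𝟙_ (FirstOrder C)).obj ⟶ par A (firstOrderObj (A.objᘁ) hA s).obj where
  hom := η_ A.obj (A.objᘁ)
  map_mem := by
    rintro ρ rfl
    change 𝟙 (𝟙_ C) ≫ η_ A.obj (A.objᘁ) ∈ parSet A.states (dualStates {ground (A.objᘁ) ≫ s})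
    rw [Category.id_comp]
    exact coevaluation_mem_parSet hs

end Caus

/-- The functor `F : Caus(C) ⥤ StProf(C₁)` is faithful. -/
theorem mainTheorem6 (C : Type u) [Category.{v} C] [MonoidalCategory C] [SymmetricCategory C]
    [RightRigidCategory C] [PrecausalCategory C] :
    (Caus.emb (C := C)).Faithful := by
  refine ⟨fun {A B f g} h => Caus.hom_ext ?_⟩
  by_cases hA : Limits.IsZero (A.objᘁ)
  · exact Caus.hom_eq_of_isZero_dual hA _ _
  obtain ⟨⟨s, _, hs⟩, -⟩ := A.flat
  apply Caus.eq_of_coevaluation_comp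
  have h₁ : Caus.coevaluationPar A hA s hs ≫ Caus.parHom f (𝟙 _) =
      Caus.coevaluationPar A hA s hs ≫ Caus.parHom g (𝟙 _) :=
    congrArg (fun k : StrongNatTrans (Caus.embObj A) (Caus.embObj B) =>
      k.nat.app (op (𝟙_ (Caus.FirstOrder C)), Caus.firstOrderObj (A.objᘁ) hA s)
        (Caus.coevaluationPar A hA s hs)) h
  have h₂ : η_ A.obj (A.objᘁ) ≫ (f.hom ⊗ₘ 𝟙 (A.objᘁ)) =
      η_ A.obj (A.objᘁ) ≫ (g.hom ⊗ₘ 𝟙 (A.objᘁ)) := congrArg Caus.Hom.hom h₁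
  simpa only [tensorHom_id] using h₂
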